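/- Let $\mathbb{H}$ be the real quaternions and let $\mathfrak{G} = \mathbb{H} \oplus \mathbb{H}e_4$, $e_4^2 = -1$, be the division Cayley algebra (the octonions), with multiplication $(m + a e_4)(n + b e_4) = (mn - \overline{b}a) + (a\overline{n} + bm)e_4$ and conjugation $\overline{m + a e_4} = \overline{m} - a e_4$ for $m, n, a, b \in \mathbb{H}$. Let $\mathfrak{J}(3,\mathfrak{G}) = \{X \in M(3,\mathfrak{G}) \mid X^* = X\}$ be the exceptional Jordan algebra of $3 \times 3$ Hermitian matrices over $\mathfrak{G}$, with Jordan multiplication $X \circ Y = \frac12 (XY + YX)$, and let $F_4$ be the compact group of all $\mathbb{R}$-linear bijections $\alpha$ of $\mathfrak{J}(3,\mathfrak{G})$ onto itself such that $\alpha(X \circ Y) = \alpha X \circ \alpha Y$ for all $X, Y \in \mathfrak{J}(3,\mathfrak{G})$. **Theorem 1.** For every $X \in \mathfrak{J}(3,\mathfrak{G})$ there exist $\alpha \in F_4$ and real numbers $\xi_1, \xi_2, \xi_3$ such that $$\alpha X = \begin{pmatrix} \xi_1 & 0 & 0 \\ 0 & \xi_2 & 0 \\ 0 & 0 & \xi_3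 \end{pmatrix}.$$ -/

import Mathlib

noncomputable section

/-- The division Cayley algebra `𝔊 = ℍ ⊕ ℍ e₄`: the pair `⟨m, a⟩` stands for `m + a e₄`. -/
@[ext]
structure Cayley where
  fst : Quaternion ℝ
  snd : Quaternion ℝ

namespace Cayley

instance : Zero Cayley := ⟨⟨0, 0⟩⟩
instance : One Cayley := ⟨⟨1, 0⟩⟩
instance : Add Cayley := ⟨fun x y => ⟨x.fst + y.fst, x.snd + y.snd⟩⟩
instance : Neg Cayley := ⟨fun x => ⟨-x.fst, -x.snd⟩⟩
instance : Sub Cayley := ⟨fun x y => ⟨x.fst - y.fst, x.snd - y.snd⟩⟩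
instance {R : Type*} [SMul R (Quaternion ℝ)] : SMul R Cayley :=
  ⟨fun r x => ⟨r • x.fst, r • x.snd⟩⟩

/-- `(m + a e₄)(n + b e₄) = (m n - b̄ a) + (a n̄ + b m) e₄`; in particular `e₄² = -1`. -/
instance : Mul Cayley :=
  ⟨fun x y => ⟨x.fst * y.fst - star y.snd * x.snd, x.snd * star y.fst + y.snd * x.fst⟩⟩

/-- The conjugation `m + a e₄ ↦ m̄ - a e₄`. -/
instance : Star Cayley := ⟨fun x => ⟨star x.fst, -x.snd⟩⟩

@[simp] theorem fst_zero : (0 : Cayley).fst = 0 := rfl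
@[simp] theorem snd_zero : (0 : Cayley).snd = 0 := rfl
@[simp] theorem fst_one : (1 : Cayley).fst = 1 := rfl
@[simp] theorem snd_one : (1 : Cayley).snd = 0 := rfl
@[simp] theorem fst_add (x y : Cayley) : (x + y).fst = x.fst + y.fst := rfl
@[simp] theorem snd_add (x y : Cayley) : (x + y).snd = x.snd + y.snd := rfl
@[simp] theorem fst_neg (x : Cayley) : (-x).fst = -x.fst := rfl
@[simp] theorem snd_neg (x : Cayley) : (-x).snd = -x.snd := rfl
@[simp] theorem fst_sub (x y : Cayley) : (x - y).fst = x.fst - y.fst := rfl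
@[simp] theorem snd_sub (x y : Cayley) : (x - y).snd = x.snd - y.snd := rfl
@[simp] theorem fst_smul {R : Type*} [SMul R (Quaternion ℝ)] (r : R) (x : Cayley) :
    (r • x).fst = r • x.fst := rfl
@[simp] theorem snd_smul {R : Type*} [SMul R (Quaternion ℝ)] (r : R) (x : Cayley) :
    (r • x).snd = r • x.snd := rfl
@[simp] theorem fst_mul (x y : Cayley) :
    (x * y).fst = x.fst * y.fst - star y.snd * x.snd := rfl
@[simp] theorem snd_mul (x y : Cayley) :
    (x * y).snd = x.snd * star y.fst + y.snd * x.fst := rfl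
@[simp] theorem fst_star (x : Cayley) : (star x).fst = star x.fst := rfl
@[simp] theorem snd_star (x : Cayley) : (star x).snd = -x.snd := rfl

/-- The additive embedding of `𝔊` as pairs of quaternions. -/
def toPair (x : Cayley) : Quaternion ℝ × Quaternion ℝ := (x.fst, x.snd)

theorem toPair_injective : Function.Injective toPair := fun _ _ h =>
  Cayley.ext (congrArg Prod.fst h) (congrArg Prod.snd h)

instance : AddCommGroup Cayley :=
  toPair_injective.addCommGroup toPair rfl (fun _ _ => rfl) (fun _ => rfl) (fun _ _ => rfl)
    (fun _ _ => rfl) (fun _ _ => rfl)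

instance : Module ℝ Cayley :=
  toPair_injective.module ℝ
    { toFun := toPair, map_zero' := rfl, map_add' := fun _ _ => rfl } (fun _ _ => rfl)

instance : NonAssocRing Cayley where
  left_distrib x y z := by ext1 <;> simp [mul_add, add_mul] <;> abel
  right_distrib x y z := by ext1 <;> simp [mul_add, add_mul] <;> abel
  zero_mul x := by ext1 <;> simp
  mul_zero x := by ext1 <;> simp
  one_mul x := by ext1 <;> simp
  mul_one x := by ext1 <;> simp

instance : StarRing Cayley where
  star_involutive x := by ext1 <;> simp
  star_mul x y := by ext1 <;> simp
  star_add x y := by ext1 <;> simp [add_comm]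

instance : StarModule ℝ Cayley where
  star_smul r x := by ext1 <;> simp

instance : IsScalarTower ℝ Cayley Cayley where
  smul_assoc r x y := by ext1 <;> simp [smul_sub, smul_add]

instance : SMulCommClass ℝ Cayley Cayley where
  smul_comm r x y := by ext1 <;> simp [smul_sub, smul_add]

end Cayley

/-- The real vector space `𝔍(3, 𝔊) = {X ∈ M(3, 𝔊) | X* = X}`. -/
abbrev ExceptionalJordan : Submodule ℝ (Matrix (Fin 3) (Fin 3) Cayley) :=
  selfAdjoint.submodule ℝ (Matrix (Fin 3) (Fin 3) Cayley)

namespace ExceptionalJordan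

/-- The Jordan multiplication `X ∘ Y = (XY + YX) / 2`. -/
def jordanMul (X Y : ExceptionalJordan) : ExceptionalJordan :=
  ⟨(1 / 2 : ℝ) • (X.1 * Y.1 + Y.1 * X.1), by
    have hX : star X.1 = X.1 := X.2
    have hY : star Y.1 = Y.1 := Y.2
    change star _ = _
    rw [star_smul, star_add, star_mul, star_mul, hX, hY, add_comm, star_trivial]⟩

end ExceptionalJordan

/-- The compact group `F₄`: the `ℝ`-linear automorphisms of `𝔍(3, 𝔊)` that preserve the
Jordan multiplication. -/
def F4 : Subgroup (ExceptionalJordan ≃ₗ[ℝ] ExceptionalJordan) where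
  carrier := {α | ∀ X Y, α (ExceptionalJordan.jordanMul X Y) =
    ExceptionalJordan.jordanMul (α X) (α Y)}
  mul_mem' {α β} hα hβ X Y := by
    simp only [Set.mem_ofPred_eq] at hα hβ
    simp only [LinearEquiv.mul_apply, hβ, hα]
  one_mem' _ _ := rfl
  inv_mem' {α} hα X Y := by
    apply α.injective
    have h (Z : ExceptionalJordan) : α (α⁻¹ Z) = Z := α.apply_symm_apply Z
    simp only [Set.mem_ofPred_eq] at hα
    rw [hα, h, h, h]

end

/-! Jacobi's eigenvalue method, run through compactness. The linear maps preserving tr X² and tr X³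
form a compact set, and each lies in F₄: polarizing the cubic form recovers tr((X ∘ Y)Z), and the
positive definite trace form then determines X ∘ Y (`exists_mem_F4`). Hence the sum of squared
diagonal entries attains its maximum over the images of X under such maps (`exists_maximal_diagSq`).
A maximizer has no nonzero off-diagonal entry (`exists_diagSq_lt`). Otherwise a permutation moves
the entry to position (0, 1), a triality twist makes it a real r ≠ 0, and a real plane rotation
kills it. This raises the diagonal sum by 2r². Non-associativity does little harm, since `re` kills
associators and real matrices associate with all others; only the twist needs a Moufang identity. -/

noncomputable section

open scoped Quaternion

/-! ### Norm, real part and alternative laws of the Cayley numbers -/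

namespace Cayley

/-- The real part of a Cayley number. -/
def re : Cayley →ₗ[ℝ] ℝ where
  toFun x := x.fst.re
  map_add' _ _ := rfl
  map_smul' _ _ := rfl

theorem re_apply (x : Cayley) : re x = x.fst.re := rfl

theorem ext_components {x y : Cayley} (h0 : x.fst.re = y.fst.re) (h1 : x.fst.imI = y.fst.imI)
    (h2 : x.fst.imJ = y.fst.imJ) (h3 : x.fst.imK = y.fst.imK) (h4 : x.snd.re = y.snd.re)
    (h5 : x.snd.imI = y.snd.imI) (h6 : x.snd.imJ = y.snd.imJ) (h7 : x.snd.imK = y.snd.imK) :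
    x = y :=
  Cayley.ext (QuaternionAlgebra.ext h0 h1 h2 h3) (QuaternionAlgebra.ext h4 h5 h6 h7)

/-- The squared Euclidean norm of a Cayley number. -/
def normSq (x : Cayley) : ℝ := re (x * star x)

theorem re_star (x : Cayley) : re (star x) = re x := by simp [re_apply]

theorem re_one : re 1 = 1 := by simp [re_apply]

theorem re_mul_comm (x y : Cayley) : re (x * y) = re (y * x) := by
  simp [re_apply]; ring

theorem re_mul_assoc (x y z : Cayley) : re (x * y * z) = re (x * (y * z)) := by
  simp [re_apply]; ring

theorem normSq_eq (x : Cayley) : normSq x =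
    x.fst.re ^ 2 + x.fst.imI ^ 2 + x.fst.imJ ^ 2 + x.fst.imK ^ 2 +
      (x.snd.re ^ 2 + x.snd.imI ^ 2 + x.snd.imJ ^ 2 + x.snd.imK ^ 2) := by
  simp [normSq, re_apply]; ring

theorem normSq_nonneg (x : Cayley) : 0 ≤ normSq x := by
  rw [normSq_eq]; positivity

theorem normSq_eq_zero {x : Cayley} : normSq x = 0 ↔ x = 0 := by
  constructor
  · intro h
    rw [normSq_eq] at h
    apply ext_components <;> simp <;> nlinarith only [h, sq_nonneg x.fst.re, sq_nonneg x.fst.imI,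
      sq_nonneg x.fst.imJ, sq_nonneg x.fst.imK, sq_nonneg x.snd.re, sq_nonneg x.snd.imI,
      sq_nonneg x.snd.imJ, sq_nonneg x.snd.imK]
  · rintro rfl
    simp [normSq]

theorem star_mul_self (x : Cayley) : star x * x = normSq x • (1 : Cayley) := by
  rw [normSq_eq]; apply ext_components <;> simp <;> ring

theorem star_mul_mul (a x : Cayley) : star a * (a * x) = normSq a • x := by
  rw [normSq_eq]; apply ext_components <;> simp <;> ring

theorem normSq_star (x : Cayley) : normSq (star x) = normSq x := by
  rw [normSq, normSq, star_star, re_mul_comm]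

theorem mul_star_mul (a x : Cayley) : a * (star a * x) = normSq a • x := by
  simpa [normSq_star] using star_mul_mul (star a) x

theorem normSq_mul (x y : Cayley) : normSq (x * y) = normSq x * normSq y := by
  rw [normSq, star_mul, re_mul_comm, re_mul_assoc, star_mul_mul, mul_smul_comm, map_smul,
    smul_eq_mul, re_mul_comm]
  rfl

set_option maxHeartbeats 2000000 in
/-- The middle Moufang identity. -/
theorem mul_mul_mul_self (a x y : Cayley) : (a * x) * (y * a) = a * (x * y) * a := by
  apply ext_components <;> simp <;> ring

/-- The trilinear form `Re (x y z)` is invariant under a triality twist. -/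
theorem re_triality (a x y z : Cayley) (ha : normSq a = 1) :
    re ((a * x) * (y * a) * (star a * (z * star a))) = re (x * y * z) := by
  -- Moufang gathers the first two factors into a(xy)a; the outer factors then cancel against ā(zā),
  -- up to cyclic moves under `re`.
  rw [mul_mul_mul_self, re_mul_assoc, mul_star_mul, ha, one_smul, re_mul_comm, re_mul_assoc,
    star_mul_mul, ha, one_smul, re_mul_comm]

theorem eq_re_smul_one {x : Cayley} (h : star x = x) : x = re x • (1 : Cayley) := by
  have h1 := congrArg (fun t => t.fst.imI) h
  have h2 := congrArg (fun t => t.fst.imJ) h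
  have h3 := congrArg (fun t => t.fst.imK) h
  have h4 := congrArg (fun t => t.snd.re) h
  have h5 := congrArg (fun t => t.snd.imI) h
  have h6 := congrArg (fun t => t.snd.imJ) h
  have h7 := congrArg (fun t => t.snd.imK) h
  simp at h1 h2 h3 h4 h5 h6 h7
  apply ext_components <;> simp [re_apply] <;> linarith

/-- The real vector space `𝔊` as a product of two copies of `ℍ`. -/
def pairEquiv : Cayley ≃ₗ[ℝ] Quaternion ℝ × Quaternion ℝ where
  toFun := toPair
  invFun p := ⟨p.1, p.2⟩
  map_add' _ _ := rfl
  map_smul' _ _ := rfl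
  left_inv _ := rfl
  right_inv _ := rfl

instance : FiniteDimensional ℝ Cayley := Module.Finite.equiv pairEquiv.symm

end Cayley

/-! ### The trace form and the symmetric trilinear form -/

namespace ExceptionalJordan

open Cayley Matrix

/-- The trace form `Re tr (XY)` on all matrices over the Cayley numbers. -/
def traceForm : Matrix (Fin 3) (Fin 3) Cayley →ₗ[ℝ] Matrix (Fin 3) (Fin 3) Cayley →ₗ[ℝ] ℝ :=
  LinearMap.mk₂ ℝ (fun X Y => re (trace (X * Y)))
    (fun _ _ _ => by rw [Matrix.add_mul, trace_add, map_add])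
    (fun _ _ _ => by rw [Matrix.smul_mul, trace_smul, map_smul])
    (fun _ _ _ => by rw [Matrix.mul_add, trace_add, map_add])
    (fun _ _ _ => by rw [Matrix.mul_smul, trace_smul, map_smul])

theorem traceForm_apply (X Y : Matrix (Fin 3) (Fin 3) Cayley) :
    traceForm X Y = ∑ i, ∑ j, re (X i j * Y j i) := by
  simp [traceForm, trace, Matrix.mul_apply]

theorem traceForm_comm (X Y : Matrix (Fin 3) (Fin 3) Cayley) :
    traceForm X Y = traceForm Y X := by
  rw [traceForm_apply, traceForm_apply, Finset.sum_comm]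
  simp_rw [re_mul_comm]

theorem traceForm_mul_left (X Y Z : Matrix (Fin 3) (Fin 3) Cayley) :
    traceForm (X * Y) Z = traceForm X (Y * Z) := by
  simp only [traceForm_apply, Matrix.mul_apply, Finset.sum_mul, Finset.mul_sum, map_sum,
    re_mul_assoc]
  exact Finset.sum_congr rfl fun i _ => Finset.sum_comm

theorem apply_swap (X : ExceptionalJordan) (i j : Fin 3) : X.1 j i = star (X.1 i j) := by
  have h : star X.1 = X.1 := X.2
  nth_rewrite 1 [← h]
  rfl

theorem apply_diag (X : ExceptionalJordan) (i : Fin 3) :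
    X.1 i i = re (X.1 i i) • (1 : Cayley) :=
  eq_re_smul_one (apply_swap X i i).symm

theorem traceForm_self (X : ExceptionalJordan) :
    traceForm X.1 X.1 = ∑ i, ∑ j, normSq (X.1 i j) := by
  rw [traceForm_apply]
  refine Finset.sum_congr rfl fun i _ => Finset.sum_congr rfl fun j _ => ?_
  rw [apply_swap X i j, normSq]

theorem traceForm_self_nonneg (X : ExceptionalJordan) : 0 ≤ traceForm X.1 X.1 := by
  rw [traceForm_self]
  exact Finset.sum_nonneg fun i _ => Finset.sum_nonneg fun j _ => normSq_nonneg _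

theorem eq_zero_of_traceForm_self (X : ExceptionalJordan) (h : traceForm X.1 X.1 = 0) :
    X = 0 := by
  rw [traceForm_self] at h
  refine Subtype.ext (Matrix.ext fun i j => normSq_eq_zero.1 ?_)
  have hi := (Finset.sum_eq_zero_iff_of_nonneg
    fun i _ => Finset.sum_nonneg fun j _ => normSq_nonneg (X.1 i j)).1 h i (Finset.mem_univ i)
  exact (Finset.sum_eq_zero_iff_of_nonneg fun j _ => normSq_nonneg (X.1 i j)).1 hi j
    (Finset.mem_univ j)

/-- The Jordan multiplication as a bilinear map. -/
def jordanBilin : ExceptionalJordan →ₗ[ℝ] ExceptionalJordan →ₗ[ℝ] ExceptionalJordan :=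
  LinearMap.mk₂ ℝ jordanMul
    (fun X Y Z => Subtype.ext <| by
      simp only [jordanMul, Submodule.coe_add, Matrix.add_mul, Matrix.mul_add, ← smul_add]
      congr 1; abel)
    (fun r X Y => Subtype.ext <| by
      simp only [jordanMul, Submodule.coe_smul, Matrix.smul_mul, Matrix.mul_smul, ← smul_add]
      rw [smul_comm])
    (fun X Y Z => Subtype.ext <| by
      simp only [jordanMul, Submodule.coe_add, Matrix.add_mul, Matrix.mul_add, ← smul_add]
      congr 1; abel)
    (fun r X Y => Subtype.ext <| by
      simp only [jordanMul, Submodule.coe_smul, Matrix.smul_mul, Matrix.mul_smul, ← smul_add]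
      rw [smul_comm])

theorem jordanBilin_apply (X Y : ExceptionalJordan) : jordanBilin X Y = jordanMul X Y := rfl

/-- The trilinear form `tr (X ∘ Y, Z)`. -/
def triForm (X Y Z : ExceptionalJordan) : ℝ := traceForm (jordanMul X Y).1 Z.1

theorem triForm_eq (X Y Z : ExceptionalJordan) : triForm X Y Z =
    (1 / 2) * (traceForm (X.1 * Y.1) Z.1 + traceForm (Y.1 * X.1) Z.1) := by
  simp only [triForm, jordanMul, map_smul, map_add, LinearMap.smul_apply, LinearMap.add_apply,
    smul_eq_mul]

theorem triForm_self (X : ExceptionalJordan) : triForm X X X = traceForm (X.1 * X.1) X.1 := by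
  rw [triForm_eq]; ring

theorem jordanMul_comm (X Y : ExceptionalJordan) : jordanMul X Y = jordanMul Y X :=
  Subtype.ext <| by simp only [jordanMul, add_comm]

theorem triForm_swap_left (X Y Z : ExceptionalJordan) : triForm X Y Z = triForm Y X Z := by
  rw [triForm, jordanMul_comm, triForm]

/-- Associativity and symmetry of the trace form; with `triForm_swap_left` this gives full symmetry,
which polarization needs. -/
theorem triForm_rotate (X Y Z : ExceptionalJordan) : triForm X Y Z = triForm Y Z X := by
  rw [triForm_eq, triForm_eq, traceForm_mul_left X, traceForm_comm X.1, traceForm_comm _ Z.1,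
    ← traceForm_mul_left Z.1]

theorem triForm_add_left (X X' Y Z : ExceptionalJordan) :
    triForm (X + X') Y Z = triForm X Y Z + triForm X' Y Z := by
  simp only [triForm, ← jordanBilin_apply, map_add, LinearMap.add_apply, Submodule.coe_add]

theorem triForm_add_middle (X Y Y' Z : ExceptionalJordan) :
    triForm X (Y + Y') Z = triForm X Y Z + triForm X Y' Z := by
  simp only [triForm, ← jordanBilin_apply, map_add, LinearMap.add_apply, Submodule.coe_add]

theorem triForm_add_right (X Y Z Z' : ExceptionalJordan) :
    triForm X Y (Z + Z') = triForm X Y Z + triForm X Y Z' := by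
  simp only [triForm, map_add, Submodule.coe_add]

theorem triForm_polarization (X Y Z : ExceptionalJordan) :
    6 * triForm X Y Z = triForm (X + Y + Z) (X + Y + Z) (X + Y + Z)
      - triForm (X + Y) (X + Y) (X + Y) - triForm (Y + Z) (Y + Z) (Y + Z)
      - triForm (X + Z) (X + Z) (X + Z) + triForm X X X + triForm Y Y Y + triForm Z Z Z := by
  simp only [triForm_add_left, triForm_add_middle, triForm_add_right]
  have h1 := triForm_rotate X Y Z
  have h2 := triForm_rotate Y Z X
  have h3 := triForm_swap_left X Y Z
  have h4 := triForm_rotate Y X Z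
  have h5 := triForm_rotate X Z Y
  linarith

/-! ### Trace-preserving maps are Jordan automorphisms -/

/-- A linear map that preserves the quadratic form `tr X²` and the cubic form `tr X³`. -/
structure IsTracePreserving (α : ExceptionalJordan →ₗ[ℝ] ExceptionalJordan) : Prop where
  quadratic (X : ExceptionalJordan) : traceForm (α X).1 (α X).1 = traceForm X.1 X.1
  cubic (X : ExceptionalJordan) : triForm (α X) (α X) (α X) = triForm X X X

namespace IsTracePreserving

variable {α β : ExceptionalJordan →ₗ[ℝ] ExceptionalJordan}

theorem id : IsTracePreserving LinearMap.id := ⟨fun _ => rfl, fun _ => rfl⟩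

theorem comp (hα : IsTracePreserving α) (hβ : IsTracePreserving β) :
    IsTracePreserving (α ∘ₗ β) :=
  ⟨fun X => (hα.quadratic (β X)).trans (hβ.quadratic X),
    fun X => (hα.cubic (β X)).trans (hβ.cubic X)⟩

theorem traceForm_eq (hα : IsTracePreserving α) (X Y : ExceptionalJordan) :
    traceForm (α X).1 (α Y).1 = traceForm X.1 Y.1 := by
  have h := hα.quadratic (X + Y)
  simp only [map_add, Submodule.coe_add, LinearMap.add_apply, hα.quadratic] at h
  rw [traceForm_comm Y.1 X.1, traceForm_comm (α Y).1 (α X).1] at h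
  linarith

theorem triForm_eq (hα : IsTracePreserving α) (X Y Z : ExceptionalJordan) :
    triForm (α X) (α Y) (α Z) = triForm X Y Z := by
  have h := triForm_polarization (α X) (α Y) (α Z)
  simp only [← map_add, hα.cubic] at h
  rw [← triForm_polarization] at h
  linarith

theorem injective (hα : IsTracePreserving α) : Function.Injective α := by
  rw [← LinearMap.ker_eq_bot, LinearMap.ker_eq_bot']
  intro X hX
  apply eq_zero_of_traceForm_self
  rw [← hα.quadratic, hX]
  simp

theorem exists_mem_F4 (hα : IsTracePreserving α) : ∃ γ ∈ F4, ∀ X, γ X = α X := by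
  refine ⟨LinearEquiv.ofInjectiveEndo α hα.injective, fun X Y => ?_, fun X => rfl⟩
  set γ := LinearEquiv.ofInjectiveEndo α hα.injective
  have hγ (X) : γ X = α X := rfl
  rw [← sub_eq_zero]
  apply eq_zero_of_traceForm_self
  -- The defect is orthogonal to every γ Z; by surjectivity it is itself such a vector, so it is
  -- orthogonal to itself.
  obtain ⟨Z, hZ⟩ := γ.surjective (γ (jordanMul X Y) - jordanMul (γ X) (γ Y))
  nth_rewrite 2 [← hZ]
  rw [Submodule.coe_sub, map_sub, LinearMap.sub_apply, sub_eq_zero, hγ, hγ, hγ, hγ,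
    hα.traceForm_eq]
  exact (hα.triForm_eq X Y Z).symm

end IsTracePreserving

end ExceptionalJordan

namespace Matrix

/-- Matrix multiplication is associative as soon as the entries associate. -/
theorem mul_assoc_of_entries {n R : Type*} [Fintype n] [NonUnitalNonAssocSemiring R]
    (A B C : Matrix n n R) (h : ∀ i j k l, A i j * B j k * C k l = A i j * (B j k * C k l)) :
    A * B * C = A * (B * C) := by
  ext i l
  simp only [mul_apply, Finset.sum_mul, Finset.mul_sum, h]
  exact Finset.sum_comm

end Matrix

/-! ### Compactness of the isometries of a cubic form -/

section Compactness

variable {E : Type*} [NormedAddCommGroup E] [InnerProductSpace ℝ E]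

/-- The linear maps that preserve the norm and the cubic form `⟪b y y, y⟫`. -/
def cubicIsometries (b : E →ₗ[ℝ] E →ₗ[ℝ] E) : Set (E →ₗ[ℝ] E) :=
  {α | (∀ y, ‖α y‖ ^ 2 = ‖y‖ ^ 2) ∧ ∀ y, inner ℝ (b (α y) (α y)) (α y) = inner ℝ (b y y) y}

theorem exists_maximal_cubicIsometry [FiniteDimensional ℝ E] (b : E →ₗ[ℝ] E →ₗ[ℝ] E)
    {f : E → ℝ} (hf : Continuous f) (x : E) :
    ∃ α, α ∈ cubicIsometries b ∧ ∀ β, β ∈ cubicIsometries b → f (β x) ≤ f (α x) := by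
  have heval (y : E) : Continuous fun α : E →L[ℝ] E => α y := by fun_prop
  have hcubic : Continuous fun y : E => inner ℝ (b y y) y := by
    have h : Continuous (LinearMap.toContinuousLinearMap.toLinearMap ∘ₗ b :
        E →ₗ[ℝ] E →L[ℝ] E) := LinearMap.continuous_of_finiteDimensional _
    exact (h.clm_apply continuous_id).inner continuous_id
  let K : Set (E →L[ℝ] E) := {α | (α : E →ₗ[ℝ] E) ∈ cubicIsometries b}
  have hK : K = (⋂ y, {α | ‖α y‖ ^ 2 = ‖y‖ ^ 2}) ∩
      ⋂ y, {α | inner ℝ (b (α y) (α y)) (α y) = inner ℝ (b y y) y} := by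
    ext α
    simp only [Set.mem_inter_iff, Set.mem_iInter, Set.mem_ofPred_eq]
    rfl
  have hclosed : IsClosed K := by
    rw [hK]
    exact (isClosed_iInter fun y => isClosed_eq ((heval y).norm.pow 2) continuous_const).inter
      (isClosed_iInter fun y => isClosed_eq (hcubic.comp (heval y)) continuous_const)
  have hbdd : Bornology.IsBounded K := by
    refine (Metric.isBounded_closedBall (x := 0) (r := 1)).subset fun α hα => ?_
    rw [mem_closedBall_zero_iff]
    refine ContinuousLinearMap.opNorm_le_bound _ zero_le_one fun y => ?_
    rw [one_mul]
    exact ((sq_eq_sq₀ (norm_nonneg _) (norm_nonneg _)).1 (hα.1 y)).le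
  have : ProperSpace (E →L[ℝ] E) := FiniteDimensional.proper_real _
  obtain ⟨α, hα, hmax⟩ := (Metric.isCompact_of_isClosed_isBounded hclosed hbdd).exists_isMaxOn
    ⟨ContinuousLinearMap.id ℝ E, fun _ => rfl, fun _ => rfl⟩
    (hf.comp (heval x)).continuousOn
  refine ⟨α, hα, fun β hβ => ?_⟩
  exact hmax (show LinearMap.toContinuousLinearMap β ∈ K from hβ)

end Compactness

/-! ### Conjugation by real orthogonal matrices -/

namespace ExceptionalJordan

open Cayley Matrix

/-- A real matrix regarded as a matrix over the Cayley numbers. -/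
def ofReal (O : Matrix (Fin 3) (Fin 3) ℝ) : Matrix (Fin 3) (Fin 3) Cayley :=
  O.map fun r => r • (1 : Cayley)

theorem ofReal_apply (O : Matrix (Fin 3) (Fin 3) ℝ) (i j : Fin 3) :
    ofReal O i j = O i j • (1 : Cayley) := rfl

theorem ofReal_mul_assoc (O : Matrix (Fin 3) (Fin 3) ℝ)
    (A B : Matrix (Fin 3) (Fin 3) Cayley) : ofReal O * A * B = ofReal O * (A * B) :=
  mul_assoc_of_entries _ _ _ fun i j k l => by
    simp only [ofReal_apply, smul_mul_assoc, one_mul]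

theorem mul_ofReal_assoc (O : Matrix (Fin 3) (Fin 3) ℝ)
    (A B : Matrix (Fin 3) (Fin 3) Cayley) : A * ofReal O * B = A * (ofReal O * B) :=
  mul_assoc_of_entries _ _ _ fun i j k l => by
    simp only [ofReal_apply, smul_mul_assoc, mul_smul_comm, one_mul, mul_one]

theorem mul_mul_ofReal (O : Matrix (Fin 3) (Fin 3) ℝ)
    (A B : Matrix (Fin 3) (Fin 3) Cayley) : A * B * ofReal O = A * (B * ofReal O) :=
  mul_assoc_of_entries _ _ _ fun i j k l => by
    simp only [ofReal_apply, mul_smul_comm, mul_one]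

theorem ofReal_mul (O P : Matrix (Fin 3) (Fin 3) ℝ) :
    ofReal O * ofReal P = ofReal (O * P) := by
  ext1 i j
  simp only [ofReal_apply, Matrix.mul_apply, smul_mul_assoc, one_mul, smul_smul,
    Finset.sum_smul]

theorem ofReal_one : ofReal 1 = 1 := by
  ext1 i j
  by_cases h : i = j <;> simp [ofReal_apply, Matrix.one_apply, h]

theorem star_ofReal (O : Matrix (Fin 3) (Fin 3) ℝ) : star (ofReal O) = ofReal Oᵀ := by
  ext1 i j
  simp [ofReal_apply]

/-- The map `X ↦ O X Oᵀ` for a real matrix `O`. -/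
def conjReal (O : Matrix (Fin 3) (Fin 3) ℝ) : ExceptionalJordan →ₗ[ℝ] ExceptionalJordan where
  toFun X := ⟨ofReal O * X.1 * ofReal Oᵀ, by
    have hX : star X.1 = X.1 := X.2
    change star _ = _
    rw [star_mul, star_mul, hX, star_ofReal, star_ofReal, transpose_transpose, mul_mul_ofReal]⟩
  map_add' X Y := Subtype.ext <| by simp [Matrix.mul_add, Matrix.add_mul]
  map_smul' r X := Subtype.ext <| by simp

theorem coe_conjReal (O : Matrix (Fin 3) (Fin 3) ℝ) (X : ExceptionalJordan) :
    (conjReal O X).1 = ofReal O * X.1 * ofReal Oᵀ := rfl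

theorem ofReal_conj_mul {O : Matrix (Fin 3) (Fin 3) ℝ} (hO : Oᵀ * O = 1)
    (A B : Matrix (Fin 3) (Fin 3) Cayley) :
    (ofReal O * A * ofReal Oᵀ) * (ofReal O * B * ofReal Oᵀ) =
      ofReal O * (A * B) * ofReal Oᵀ := by
  rw [mul_ofReal_assoc, ← ofReal_mul_assoc, ← ofReal_mul_assoc, ofReal_mul, hO, ofReal_one,
    Matrix.one_mul, ofReal_mul_assoc, ofReal_mul_assoc, mul_mul_ofReal]

theorem traceForm_ofReal_conj {O : Matrix (Fin 3) (Fin 3) ℝ} (hO : Oᵀ * O = 1)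
    (A B : Matrix (Fin 3) (Fin 3) Cayley) :
    traceForm (ofReal O * A * ofReal Oᵀ) (ofReal O * B * ofReal Oᵀ) = traceForm A B := by
  rw [traceForm_mul_left, ← ofReal_mul_assoc, ← ofReal_mul_assoc, ofReal_mul, hO, ofReal_one,
    Matrix.one_mul, traceForm_comm, ← traceForm_mul_left, mul_ofReal_assoc, ofReal_mul, hO,
    ofReal_one, Matrix.mul_one, traceForm_comm]

theorem isTracePreserving_conjReal {O : Matrix (Fin 3) (Fin 3) ℝ} (hO : Oᵀ * O = 1) :
    IsTracePreserving (conjReal O) where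
  quadratic X := traceForm_ofReal_conj hO _ _
  cubic X := by
    rw [triForm_self, triForm_self, coe_conjReal, ofReal_conj_mul hO, traceForm_ofReal_conj hO]

theorem conjReal_apply (O : Matrix (Fin 3) (Fin 3) ℝ) (X : ExceptionalJordan) (i j : Fin 3) :
    (conjReal O X).1 i j = ∑ k, ∑ l, (O i k * O j l) • X.1 k l := by
  rw [coe_conjReal]
  simp only [Matrix.mul_apply, ofReal_apply, transpose_apply, smul_mul_assoc, one_mul,
    mul_smul_comm, mul_one, Finset.smul_sum, smul_smul]
  rw [Finset.sum_comm]
  simp only [mul_comm]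

theorem conjReal_permMatrix_apply (σ : Equiv.Perm (Fin 3)) (X : ExceptionalJordan)
    (i j : Fin 3) : (conjReal (σ.permMatrix ℝ) X).1 i j = X.1 (σ i) (σ j) := by
  rw [conjReal_apply]
  simp [Equiv.Perm.permMatrix, Equiv.toPEquiv_apply, PEquiv.toMatrix_apply]

theorem isTracePreserving_conjReal_permMatrix (σ : Equiv.Perm (Fin 3)) :
    IsTracePreserving (conjReal (σ.permMatrix ℝ)) := by
  apply isTracePreserving_conjReal
  rw [Matrix.transpose_permMatrix, ← Matrix.permMatrix_mul]
  simp

/-- The rotation by the angle with cosine `c` and sine `s` in the first two coordinates. -/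
def planeRotation (c s : ℝ) : Matrix (Fin 3) (Fin 3) ℝ := !![c, s, 0; -s, c, 0; 0, 0, 1]

theorem planeRotation_transpose_mul {c s : ℝ} (h : c ^ 2 + s ^ 2 = 1) :
    (planeRotation c s)ᵀ * planeRotation c s = 1 := by
  ext i j
  fin_cases i <;> fin_cases j <;>
    simp [planeRotation, Matrix.mul_apply, Fin.sum_univ_three] <;> linarith

/-! ### The triality twist -/

/-- The components of the triality twist by `a`. -/
def twistComponent (a : Cayley) : Fin 3 → Fin 3 → Cayley →ₗ[ℝ] Cayley :=
  let L := LinearMap.mulLeft ℝ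
  let R := LinearMap.mulRight ℝ
  ![![LinearMap.id, L a, R a ∘ₗ L a], ![R (star a), LinearMap.id, R a],
    ![L (star a) ∘ₗ R (star a), L (star a), LinearMap.id]]

theorem star_twistComponent (a x : Cayley) (i j : Fin 3) :
    star (twistComponent a i j x) = twistComponent a j i (star x) := by
  fin_cases i <;> fin_cases j <;> simp [twistComponent]

/-- The triality twist of `𝔍(3, 𝔊)` by a Cayley number `a`. -/
def twist (a : Cayley) : ExceptionalJordan →ₗ[ℝ] ExceptionalJordan where
  toFun X := ⟨of fun i j => twistComponent a i j (X.1 i j), by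
    change star _ = _
    ext1 i j
    simp only [star_apply, of_apply, star_twistComponent]
    rw [← apply_swap]⟩
  map_add' X Y := Subtype.ext <| by ext1 i j; simp
  map_smul' r X := Subtype.ext <| by ext1 i j; simp

theorem twist_apply (a : Cayley) (X : ExceptionalJordan) (i j : Fin 3) :
    (twist a X).1 i j = twistComponent a i j (X.1 i j) := rfl

theorem normSq_twistComponent {a : Cayley} (ha : normSq a = 1) (x : Cayley) (i j : Fin 3) :
    normSq (twistComponent a i j x) = normSq x := by
  fin_cases i <;> fin_cases j <;> simp [twistComponent, normSq_mul, normSq_star, ha]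

/-- Isolates the only term depending on more than diagonal entries and norms: a triple product,
which `re_triality` controls. -/
theorem cubic_eq (X : ExceptionalJordan) : triForm X X X =
    ∑ i, re (X.1 i i) ^ 3
      + 3 * (re (X.1 0 0) * (normSq (X.1 0 1) + normSq (X.1 2 0))
        + re (X.1 1 1) * (normSq (X.1 0 1) + normSq (X.1 1 2))
        + re (X.1 2 2) * (normSq (X.1 1 2) + normSq (X.1 2 0)))
      + 6 * re (X.1 0 1 * X.1 1 2 * X.1 2 0) := by
  rw [triForm_self, traceForm_apply]
  simp only [Matrix.mul_apply, Fin.sum_univ_three]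
  rw [apply_swap X 0 1, apply_swap X 1 2, apply_swap X 2 0]
  generalize X.1 0 1 = z
  generalize X.1 1 2 = x
  generalize X.1 2 0 = y
  rw [apply_diag X 0, apply_diag X 1, apply_diag X 2]
  generalize re (X.1 0 0) = a
  generalize re (X.1 1 1) = b
  generalize re (X.1 2 2) = c
  -- Conjugation and cyclic rotation identify all six triple products.
  have e1 : re (star y * star x * star z) = re (z * x * y) := by
    rw [← re_star]; simp only [star_mul, star_star]; rw [re_mul_assoc]
  have e2 : re (star x * star z * star y) = re (z * x * y) := by
    rw [re_mul_comm, ← re_mul_assoc, e1]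
  have e3 : re (star z * star y * star x) = re (z * x * y) := by
    rw [re_mul_comm, ← re_mul_assoc, e2]
  have e4 : re (x * y * z) = re (z * x * y) := by rw [re_mul_comm, re_mul_assoc]
  have e5 : re (y * z * x) = re (z * x * y) := by rw [re_mul_comm, ← re_mul_assoc, e4]
  have n (t : Cayley) : re (star t * t) = normSq t := by rw [re_mul_comm, normSq]
  have n' (t : Cayley) : re (t * star t) = normSq t := rfl
  simp only [add_mul, smul_mul_assoc, mul_smul_comm, one_mul, mul_one, map_add, map_smul,
    smul_eq_mul, e1, e2, e3, e4, e5, n, n', re_one]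
  ring

theorem isTracePreserving_twist {a : Cayley} (ha : normSq a = 1) :
    IsTracePreserving (twist a) where
  quadratic X := by
    simp only [traceForm_self, twist_apply, normSq_twistComponent ha]
  cubic X := by
    simp only [cubic_eq, twist_apply, normSq_twistComponent ha]
    have h (i) (x : Cayley) : twistComponent a i i x = x := by
      fin_cases i <;> simp [twistComponent]
    simp only [h]
    congr 2
    exact re_triality a _ _ _ ha

/-! ### Increasing the diagonal sum of squares -/

/-- The sum of the squares of the diagonal entries. -/
def diagSq (X : ExceptionalJordan) : ℝ := ∑ i, re (X.1 i i) ^ 2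

theorem exists_unit_mul_eq_smul_one {x : Cayley} (hx : x ≠ 0) :
    ∃ (a : Cayley) (r : ℝ), normSq a = 1 ∧ r ≠ 0 ∧ a * x = r • 1 := by
  have h0 : 0 < normSq x := (normSq_nonneg x).lt_of_ne fun h => hx (normSq_eq_zero.1 h.symm)
  have hr := Real.sq_sqrt h0.le
  have hr0 := (Real.sqrt_pos.2 h0).ne'
  set r := √(normSq x)
  refine ⟨r⁻¹ • star x, r, ?_, hr0, ?_⟩
  · rw [normSq, star_smul, smul_mul_assoc, mul_smul_comm, map_smul, map_smul, ← normSq,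
      normSq_star, ← hr, star_trivial, smul_eq_mul, smul_eq_mul]
    field_simp
  · rw [smul_mul_assoc, star_mul_self, smul_smul, ← hr]
    congr 1
    field_simp

/-- Intermediate values: the expression goes from r at angle 0 to -r at π/2. It is the off-diagonal
entry of a rotated symmetric 2 × 2 block. -/
theorem exists_rotation (r d : ℝ) :
    ∃ c s : ℝ, c ^ 2 + s ^ 2 = 1 ∧ (c ^ 2 - s ^ 2) * r + c * s * d = 0 := by
  let g : ℝ → ℝ := fun t =>
    (Real.cos t ^ 2 - Real.sin t ^ 2) * r + Real.cos t * Real.sin t * d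
  have hg : Continuous g := by fun_prop
  obtain ⟨t, -, ht⟩ : (0 : ℝ) ∈ g '' Set.univ := by
    apply isPreconnected_univ.image g hg.continuousOn |>.ordConnected.uIcc_subset
      (Set.mem_image_of_mem g (Set.mem_univ 0))
      (Set.mem_image_of_mem g (Set.mem_univ (Real.pi / 2)))
    have h0 : g 0 = r := by simp [g]
    have h1 : g (Real.pi / 2) = -r := by simp [g]
    rw [h0, h1, Set.mem_uIcc]
    rcases le_total 0 r with h | h
    · exact Or.inr ⟨by linarith, h⟩
    · exact Or.inl ⟨h, by linarith⟩
  exact ⟨Real.cos t, Real.sin t, by rw [add_comm]; exact Real.sin_sq_add_cos_sq t, ht⟩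

theorem exists_diagSq_lt_of_apply_zero_one (X : ExceptionalJordan) (h : X.1 0 1 ≠ 0) :
    ∃ α, IsTracePreserving α ∧ diagSq X < diagSq (α X) := by
  obtain ⟨a, r, ha, hr, hax⟩ := exists_unit_mul_eq_smul_one h
  obtain ⟨c, s, hcs, h0⟩ := exists_rotation r (re (X.1 1 1) - re (X.1 0 0))
  refine ⟨conjReal (planeRotation c s) ∘ₗ twist a,
    (isTracePreserving_conjReal (planeRotation_transpose_mul hcs)).comp
      (isTracePreserving_twist ha), ?_⟩
  have d (i) : (twist a X).1 i i = X.1 i i := by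
    rw [twist_apply]; fin_cases i <;> simp [twistComponent]
  have h01 : (twist a X).1 0 1 = r • 1 := hax
  have h10 : (twist a X).1 1 0 = r • 1 := by rw [apply_swap _ 0 1, h01]; simp
  simp only [diagSq, LinearMap.comp_apply, conjReal_apply, Fin.sum_univ_three, d, h01, h10]
  simp [planeRotation, re_one]
  generalize re (X.1 0 0) = p at *
  generalize re (X.1 1 1) = q at *
  have hr2 : 0 < r ^ 2 := by positivity
  -- Rotation preserves the sum of squares p² + q² + 2r² of the 2 × 2 block, and by `h0` its new
  -- off-diagonal entries vanish.
  have key : (c * c * p + c * s * r + (s * c * r + s * s * q)) ^ 2 +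
      (s * s * p - s * c * r + (- (c * s * r) + c * c * q)) ^ 2 = p ^ 2 + q ^ 2 + 2 * r ^ 2 := by
    linear_combination (p ^ 2 + q ^ 2 + 2 * r ^ 2) * (c ^ 2 + s ^ 2 + 1) * hcs -
      2 * ((c ^ 2 - s ^ 2) * r + c * s * (q - p)) * h0
  nlinarith [key, hr2]

theorem exists_diagSq_lt (X : ExceptionalJordan) {i j : Fin 3} (hij : i ≠ j)
    (h : X.1 i j ≠ 0) : ∃ α, IsTracePreserving α ∧ diagSq X < diagSq (α X) := by
  obtain ⟨σ, h0, h1⟩ : ∃ σ : Equiv.Perm (Fin 3), σ 0 = i ∧ σ 1 = j := by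
    clear h
    revert i j
    decide
  obtain ⟨α, hα, hlt⟩ := exists_diagSq_lt_of_apply_zero_one (conjReal (σ.permMatrix ℝ) X)
    (by rwa [conjReal_permMatrix_apply, h0, h1])
  refine ⟨_, hα.comp (isTracePreserving_conjReal_permMatrix σ), ?_⟩
  refine lt_of_eq_of_lt ?_ hlt
  simp only [diagSq, conjReal_permMatrix_apply]
  exact (Equiv.sum_comp σ fun i => re (X.1 i i) ^ 2).symm

/-! ### Existence of a maximizer -/

/-- The trace form makes `𝔍(3, 𝔊)` a Euclidean space. -/
@[reducible]
def traceCore : InnerProductSpace.Core ℝ ExceptionalJordan where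
  inner X Y := traceForm X.1 Y.1
  conj_inner_symm X Y := traceForm_comm _ _
  re_inner_nonneg X := traceForm_self_nonneg X
  add_left X Y Z := by simp
  smul_left X Y r := by simp
  definite X h := eq_zero_of_traceForm_self X h

theorem exists_maximal_diagSq (X : ExceptionalJordan) : ∃ α, IsTracePreserving α ∧
    ∀ β, IsTracePreserving β → diagSq (β X) ≤ diagSq (α X) := by
  let : NormedAddCommGroup ExceptionalJordan := traceCore.toNormedAddCommGroup
  let : InnerProductSpace ℝ ExceptionalJordan := InnerProductSpace.ofCore traceCore.toCore
  have hnorm (Y : ExceptionalJordan) : ‖Y‖ ^ 2 = traceForm Y.1 Y.1 :=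
    (real_inner_self_eq_norm_sq Y).symm
  have hdiag : Continuous diagSq := by
    refine continuous_finsetSum _ fun i _ => Continuous.pow ?_ 2
    exact LinearMap.continuous_of_finiteDimensional
      (re ∘ₗ Matrix.entryLinearMap ℝ Cayley i i ∘ₗ Submodule.subtype ExceptionalJordan)
  have hiff (α : ExceptionalJordan →ₗ[ℝ] ExceptionalJordan) : IsTracePreserving α ↔
      α ∈ cubicIsometries jordanBilin := by
    constructor
    · exact fun h => ⟨fun Y => by rw [hnorm, hnorm, h.quadratic], h.cubic⟩
    · exact fun h => ⟨fun Y => by rw [← hnorm, ← hnorm, h.1], h.2⟩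
  simp only [hiff]
  exact exists_maximal_cubicIsometry jordanBilin hdiag X

end ExceptionalJordan
end

open ExceptionalJordan in
/-- Every `X ∈ 𝔍(3, 𝔊)` is carried to a real diagonal matrix by some `α ∈ F₄`. -/
theorem theorem1 (X : ExceptionalJordan) :
    ∃ α ∈ F4, ∃ ξ : Fin 3 → ℝ,
      ((α X : ExceptionalJordan) : Matrix (Fin 3) (Fin 3) Cayley) =
        Matrix.diagonal fun i => ξ i • (1 : Cayley) := by
  obtain ⟨α, hα, hmax⟩ := exists_maximal_diagSq X
  obtain ⟨γ, hγ, hγα⟩ := hα.exists_mem_F4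
  refine ⟨γ, hγ, fun i => Cayley.re ((α X).1 i i), ?_⟩
  rw [hγα]
  ext1 i j
  by_cases hij : i = j
  · subst hij
    rw [Matrix.diagonal_apply_eq]
    exact apply_diag (α X) i
  · rw [Matrix.diagonal_apply_ne _ hij]
    by_contra h
    obtain ⟨β, hβ, hlt⟩ := exists_diagSq_lt (α X) hij h
    exact (hmax _ (hβ.comp hα)).not_gt hlt
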